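/- Notation. Let $\mathbb{N}=\{1,2,3,\dots\}$, $[l]=\{1,\dots,l\}$, and let $c_0(\mathbb{N})$ be the Banach space of null sequences over $\mathbb{K}=\mathbb{R}$ or $\mathbb{C}$, with canonical basis $(e_j)_{j\ge1}$. Let $\mathcal{A}_\infty$, $\mathcal{A}_{uBd}$, $\mathcal{A}_{ud}$, $\mathcal{A}_{ld}$ denote the families of subsets of $\mathbb{N}$ that are infinite, of positive upper Banach density, of positive upper density, and of positive lower density, respectively, where \[\underline{\mathrm{dens}}\,A=\liminf_{M\to\infty}\tfrac{|A\cap[1,M]|}{M},\quad \overline{\mathrm{dens}}\,A=\limsup_{M\to\infty}\tfrac{|A\cap[1,M]|}{M},\quad \overline{\mathrm{Bd}}\,A=\limsup_{M\to\infty}\max_{k\ge1}\tfrac{|A\cap[k+1,k+M]|}{M}.\] For a strictly increasing map $f:\mathbb{N}\to\mathbb{N}$ with $f(1)>1$ and a sequence $w=(w_j)_{j\ge1}$ in $\mathbb{K}$ such that $(w_{f(j)})_j$ is bounded, the unilateral pseudo-shift $T_{f,w}$ on $c_0(\mathbb{N})$ is the operator $T_{f,w}\big(\sum_j x_je_j\big)=\sum_j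 w_{f(j)}x_{f(j)}e_j$. Operators $T_1,\dots,T_N$ on a Banach space $X$ are disjoint $\mathcal{A}$-hypercyclic if there is $x\in X$ such that for every non-empty open set $U\subset X^N$ the set $\{n:(T_1^nx,\dots,T_N^nx)\in U\}$ belongs to $\mathcal{A}$. A family $\mathcal{A}$ of subsets of $\mathbb{N}$ is $(f_s)_{s=1}^N$-weakly partition regular if for every sequence $(B_l)_{l\ge1}\subset\mathcal{A}$ there is a sequence $(A_l)_{l\ge1}\subset\mathcal{A}$ with $A_l\subset B_l$ for all $l$ and $f_s^m([l])\cap f_t^n([k])=\emptyset$ for all $l,k\ge1$, all $m\in A_l$, $n\in A_k$ with $m\ne n$, and all $s,t\in[N]$. Theorem. Let $N\ge2$, let $T_1=T_{f_1,w_1},\dots,T_N=T_{f_N,w_N}$ be unilateral pseudo-shifts on $c_0(\mathbb{N})$, and let $\mathcal{A}$ be one of $\mathcal{A}_\infty$, $\mathcal{A}_{uBd}$, $\mathcal{A}_{ud}$, $\mathcal{A}_{ld}$. Put $W^s_{j,n}=\prod_{\nu=1}^n w_{s,f_s^\nu(j)}$. Suppose that $\mathcal{A}$ is $(f_s)_{s=1}^N$-weakly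 partition regular. Then $T_1,\dots,T_N$ are disjoint $\mathcal{A}$-hypercyclic if and only if there exist sets $A_k\in\mathcal{A}$, $k\ge1$, and a sequence $(\varepsilon_k)_{k\ge1}$ of positive real numbers tending to $0$ such that the following hold. \begin{enumerate} \item For all $1\le j\le k$ and all $s\in[N]$, $\lim_{n\in A_k,\,n\to\infty}|W^s_{j,n}|=\infty$; and for all $l,k\ge1$, all $n\in A_l$, $m\in A_k$, all $s\in[N]$ and all $j\in f_s^m([k])\cap f_s^n((l,\infty))$, \[\frac{|W^s_{f_s^{-n}(j),n}|}{|W^s_{f_s^{-m}(j),m}|}\le\min\{\varepsilon_l,\varepsilon_k\}.\] (The first part forces $w_{s,f_s(j)}\ne0$ for all $s$ and $j$, so all quotients here and below are well defined.) \item For all $1\le j\le l$, all $k\ge1$, all $n\in A_k$, all $s\ne t$ in $[N]$ and all $m\in A_l\setminus\{n\}$: if $f_t^m(j)\in f_s^n((k,\infty))$ then \[\frac{|W^s_{f_s^{-n}(f_t^m(j)),n}|}{|W^t_{j,m}|}\le\varepsilon_l.\] \item For all $1\le j\le k<l$, all $n\in A_l$, all $s\ne t$ in $[N]$ and all $m\in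 A_k$: if $f_t^m(j)\in f_s^n((l,\infty))$ then \[\frac{|W^s_{f_s^{-n}(f_t^m(j)),n}|}{|W^t_{j,m}|}\le\varepsilon_l.\] \item For all $l\ge1$, all $(a_{s,j})_{s\in[N],j\in[l]}$ in $\mathbb{K}\setminus\{0\}$ and all $\varepsilon>0$ there is $L\ge l$ such that for all $s\ne t$ in $[N]$ and all $n\in A_L$: \begin{enumerate} \item for every $j\in f_t^n([l])\cap f_s^n([l])$, \[\left|\frac{W^s_{f_s^{-n}(j),n}}{W^t_{f_t^{-n}(j),n}}-\frac{a_{s,f_s^{-n}(j)}}{a_{t,f_t^{-n}(j)}}\right|\le\varepsilon;\] \item for every $j\in f_t^n([l])\cap f_s^n((l,\infty))$, \[\frac{|W^s_{f_s^{-n}(j),n}|}{|W^t_{f_t^{-n}(j),n}|}\le\varepsilon.\] \end{enumerate} \end{enumerate} -/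

import Mathlib

open Filter Topology Set
open scoped ZeroAtInfty

/-! ### Families of sets of natural numbers -/

/-- The lower density of a set of natural numbers. -/
noncomputable def lowerDens (A : Set ℕ) : ℝ :=
  liminf (fun N : ℕ => ((A ∩ Set.Icc 1 N).ncard : ℝ) / N) atTop

/-- The upper density of a set of natural numbers. -/
noncomputable def upperDens (A : Set ℕ) : ℝ :=
  limsup (fun N : ℕ => ((A ∩ Set.Icc 1 N).ncard : ℝ) / N) atTop

/-- The upper Banach density of a set of natural numbers; the windows are
`[k + 1, k + N]` with `k ≥ 1`. -/
noncomputable def upperBanachDens (A : Set ℕ) : ℝ :=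
  limsup (fun N : ℕ => ⨆ k : ℕ+, ((A ∩ Set.Icc ((k : ℕ) + 1) (k + N)).ncard : ℝ) / N) atTop

/-- The family of infinite sets. -/
def infiniteSets : Set (Set ℕ) := {A | A.Infinite}

/-- The family of sets of positive upper Banach density. -/
def posUpperBanachDens : Set (Set ℕ) := {A | 0 < upperBanachDens A}

/-- The family of sets of positive upper density. -/
def posUpperDens : Set (Set ℕ) := {A | 0 < upperDens A}

/-- The family of sets of positive lower density. -/
def posLowerDens : Set (Set ℕ) := {A | 0 < lowerDens A}

/-! ### Disjoint hypercyclicity -/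

/-- `x` is an `𝒜`-hypercyclic vector for `T`: the set of times at which the orbit of `x` visits a
non-empty open set always belongs to `𝒜`. -/
def IsHypercyclicVector {𝕜 X : Type*} [RCLike 𝕜] [NormedAddCommGroup X] [NormedSpace 𝕜 X]
    (𝒜 : Set (Set ℕ)) (T : X →L[𝕜] X) (x : X) : Prop :=
  ∀ U : Set X, IsOpen U → U.Nonempty → {n : ℕ | (T ^ n) x ∈ U} ∈ 𝒜

/-- `T₁, …, T_N` are disjoint `𝒜`-hypercyclic: the direct sum `T₁ ⊕ ⋯ ⊕ T_N` on `X^N` has an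
`𝒜`-hypercyclic vector of the form `(x, …, x)`. -/
def DisjointHypercyclic {𝕜 X : Type*} [RCLike 𝕜] [NormedAddCommGroup X] [NormedSpace 𝕜 X]
    (𝒜 : Set (Set ℕ)) {N : ℕ} (T : Fin N → X →L[𝕜] X) : Prop :=
  ∃ x : X, IsHypercyclicVector 𝒜 (ContinuousLinearMap.piMap T) (fun _ : Fin N => x)

/-! ### Unilateral pseudo-shifts on `c₀` -/

theorem pseudoShift_tendsto {𝕜 : Type*} [RCLike 𝕜] {f : ℕ+ → ℕ+} (hf : StrictMono f)
    {w : ℕ+ → 𝕜} (hw : ∃ C : ℝ, ∀ j, ‖w (f j)‖ ≤ C) (x : C₀(ℕ+, 𝕜)) :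
    Tendsto (fun j => w (f j) * x (f j)) (cocompact ℕ+) (𝓝 0) := by
  obtain ⟨C, hC⟩ := hw
  have h1 : Tendsto f (cocompact ℕ+) (cocompact ℕ+) := by
    rw [cocompact_eq_cofinite]
    exact hf.injective.tendsto_cofinite
  have h2 : Tendsto (fun j => x (f j)) (cocompact ℕ+) (𝓝 0) := (zero_at_infty x).comp h1
  have h3 : Tendsto (fun j => C * ‖x (f j)‖) (cocompact ℕ+) (𝓝 0) := by
    simpa using h2.norm.const_mul C
  refine squeeze_zero_norm (fun j => ?_) h3
  rw [norm_mul]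
  exact mul_le_mul_of_nonneg_right (hC j) (norm_nonneg _)

/-- The unilateral pseudo-shift `T_{f,w}` on `c₀(ℕ)`, the coordinates being indexed by
`1, 2, 3, …`: it sends `(x_j)` to `(w_{f(j)} x_{f(j)})`. The hypothesis on the weights says exactly
that this defines a bounded operator. -/
noncomputable def pseudoShift {𝕜 : Type*} [RCLike 𝕜] (f : ℕ+ → ℕ+) (hf : StrictMono f)
    (w : ℕ+ → 𝕜) (hw : ∃ C : ℝ, ∀ j, ‖w (f j)‖ ≤ C) : C₀(ℕ+, 𝕜) →L[𝕜] C₀(ℕ+, 𝕜) :=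
  LinearMap.mkContinuousOfExistsBound
    { toFun := fun x =>
        { toFun := fun j => w (f j) * x (f j)
          continuous_toFun := continuous_of_discreteTopology
          zero_at_infty' := pseudoShift_tendsto hf hw x }
      map_add' := fun x y => by
        ext j
        exact mul_add _ _ _
      map_smul' := fun c x => by
        ext j
        exact mul_left_comm _ _ _ }
    (by
      obtain ⟨C, hC⟩ := hw
      refine ⟨C, fun x => ?_⟩
      have hC0 : 0 ≤ C := (norm_nonneg _).trans (hC 1)
      rw [← ZeroAtInftyContinuousMap.norm_toBCF_eq_norm,
        ← ZeroAtInftyContinuousMap.norm_toBCF_eq_norm]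
      refine (BoundedContinuousFunction.norm_le (mul_nonneg hC0 (norm_nonneg _))).2 fun j => ?_
      refine (norm_mul (w (f j)) (x (f j))).le.trans ?_
      exact mul_le_mul (hC j) (x.toBCF.norm_coe_le_norm (f j)) (norm_nonneg _) hC0)

theorem pseudoShift_apply {𝕜 : Type*} [RCLike 𝕜] (f : ℕ+ → ℕ+) (hf : StrictMono f)
    (w : ℕ+ → 𝕜) (hw : ∃ C : ℝ, ∀ j, ‖w (f j)‖ ≤ C) (x : C₀(ℕ+, 𝕜)) (j : ℕ+) :
    pseudoShift f hf w hw x j = w (f j) * x (f j) := rfl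

/-- The weight product `W_{j,n} = ∏_{ν = 1}^{n} w_{f^ν(j)}`. -/
noncomputable def weightProd {𝕜 : Type*} [RCLike 𝕜] (f : ℕ+ → ℕ+) (w : ℕ+ → 𝕜)
    (j : ℕ+) (n : ℕ) : 𝕜 :=
  ∏ ν ∈ Finset.Icc 1 n, w (f^[ν] j)

/-- `𝒜` is `(f_s)`-weakly partition regular. Here `[l] = {1, …, l}` is `Set.Iic l` in `ℕ+`. -/
def WeaklyPartitionRegular {N : ℕ} (f : Fin N → ℕ+ → ℕ+) (𝒜 : Set (Set ℕ)) : Prop :=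
  ∀ B : ℕ+ → Set ℕ, (∀ l, B l ∈ 𝒜) → ∃ A : ℕ+ → Set ℕ, (∀ l, A l ∈ 𝒜) ∧ (∀ l, A l ⊆ B l) ∧
    ∀ l k : ℕ+, ∀ m ∈ A l, ∀ n ∈ A k, m ≠ n → ∀ s t : Fin N,
      (f s)^[m] '' Set.Iic l ∩ (f t)^[n] '' Set.Iic k = ∅

/-! ### Families of sets of natural numbers -/

/-! The coordinate of `T_s^n x` at `i` is `W^s_{i,n}` times the coordinate of `x` at `f_s^n(i)`.
When two index pairs reach the same point of `x`, that common coordinate cancels from a quotient, so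
control of orbits and control of weight ratios can be traded for each other.

Necessity: a countable family of nowhere vanishing arrays is dense on every initial segment. `A L`
is the set of times at which the orbit is close to a target carrying a large multiple of the `L`-th
array on its first coordinates and vanishing beyond `L`. Orbit coordinates are large up to `L` and
at most `1/(2L)` after it, which bounds the ratios; the multiple cancels when prescribed quotients
are approximated.

Sufficiency: weak partition regularity separates the initial blocks reached at different times. For
the `r`-th array choose a large index `L r`, and let `x` have coordinate `d r t p / W^t_{p,n}` at
`f_t^n(p)`. Several `t` may compete for one point at the same time `n`; the prescribed ratios make
all choices nearly equivalent. The remaining collisions meet coordinates beyond a block, where the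
ratio bounds make them negligible. Each non-empty open set is then visited along a tail of some `A
(L r)`, and the families are stable under passing to tails and to supersets. -/

theorem ncard_inter_le_add {A B : Set ℕ} {n₀ : ℕ} (h : A ∩ Ici n₀ ⊆ B) (a b : ℕ) :
    (A ∩ Icc a b).ncard ≤ (B ∩ Icc a b).ncard + n₀ := by
  have hsub : A ∩ Icc a b ⊆ (B ∩ Icc a b) ∪ Iio n₀ := by
    rintro x ⟨hA, hx⟩
    rcases lt_or_ge x n₀ with h' | h'
    · exact Or.inr h'
    · exact Or.inl ⟨h ⟨hA, h'⟩, hx⟩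
  have hfin : (B ∩ Icc a b).Finite := (finite_Icc a b).subset inter_subset_right
  refine (ncard_le_ncard hsub (hfin.union (finite_Iio n₀))).trans ((ncard_union_le _ _).trans ?_)
  have : (Iio n₀).ncard = n₀ := by
    rw [← Finset.coe_Iio, ncard_coe_finset, Nat.card_Iio]
  rw [this]

theorem ncard_window_div_mem (A : Set ℕ) (k M : ℕ) :
    ((A ∩ Icc (k + 1) (k + M)).ncard : ℝ) / M ∈ Icc (0 : ℝ) 1 := by
  refine ⟨by positivity, div_le_one_of_le₀ ?_ (by positivity)⟩
  have h : (A ∩ Icc (k + 1) (k + M)).ncard ≤ (Icc (k + 1) (k + M)).ncard :=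
    ncard_le_ncard inter_subset_right (finite_Icc _ _)
  rw [← Finset.coe_Icc, ncard_coe_finset, Nat.card_Icc] at h
  have h' : (A ∩ Icc (k + 1) (k + M)).ncard ≤ M := by
    rw [Finset.coe_Icc] at h
    omega
  exact_mod_cast h'

theorem ncard_Icc_one_div_mem (A : Set ℕ) (M : ℕ) :
    ((A ∩ Icc 1 M).ncard : ℝ) / M ∈ Icc (0 : ℝ) 1 := by
  simpa using ncard_window_div_mem A 0 M

/-- Discarding boundedly many points costs `C / M` in the counting ratio, eventually less than half
of any positive level. -/
theorem eventually_half_lt_of_lt {u v : ℕ → ℝ} {C c : ℝ} (hc : 0 < c)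
    (huv : ∀ M, u M ≤ v M + C / M) : ∀ᶠ M in atTop, c < u M → c / 2 ≤ v M := by
  have h0 : Tendsto (fun M : ℕ => C / M) atTop (𝓝 0) := tendsto_const_div_atTop_nhds_zero_nat C
  filter_upwards [h0.eventually (gt_mem_nhds (half_pos hc))] with M hM hu
  linarith [huv M]

theorem liminf_pos_of_le_add_div {u v : ℕ → ℝ} {C : ℝ} (hu : ∀ M, u M ∈ Icc (0 : ℝ) 1)
    (hv : ∀ M, v M ∈ Icc (0 : ℝ) 1) (huv : ∀ M, u M ≤ v M + C / M)
    (h : 0 < liminf u atTop) : 0 < liminf v atTop := by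
  obtain ⟨c, hc0, hc⟩ := exists_between h
  have h1 : ∀ᶠ M in atTop, c < u M :=
    eventually_lt_of_lt_liminf hc (isBoundedUnder_of ⟨0, fun M => (hu M).1⟩)
  have h2 : ∀ᶠ M in atTop, c / 2 ≤ v M := by
    filter_upwards [h1, eventually_half_lt_of_lt hc0 huv] with M h1 h2 using h2 h1
  exact (half_pos hc0).trans_le
    (le_liminf_of_le (isBoundedUnder_of ⟨1, fun M => (hv M).2⟩).isCoboundedUnder_ge h2)

theorem limsup_pos_of_le_add_div {u v : ℕ → ℝ} {C : ℝ} (hu : ∀ M, u M ∈ Icc (0 : ℝ) 1)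
    (hv : ∀ M, v M ∈ Icc (0 : ℝ) 1) (huv : ∀ M, u M ≤ v M + C / M)
    (h : 0 < limsup u atTop) : 0 < limsup v atTop := by
  obtain ⟨c, hc0, hc⟩ := exists_between h
  have h1 : ∃ᶠ M in atTop, c < u M :=
    frequently_lt_of_lt_limsup (isBoundedUnder_of ⟨0, fun M => (hu M).1⟩).isCoboundedUnder_le hc
  have h2 : ∃ᶠ M in atTop, c / 2 ≤ v M := h1.mp (eventually_half_lt_of_lt hc0 huv)
  exact (half_pos hc0).trans_le
    (le_limsup_of_frequently_le h2 (isBoundedUnder_of ⟨1, fun M => (hv M).2⟩))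

theorem iSup_window_mem (A : Set ℕ) (M : ℕ) :
    (⨆ k : ℕ+, ((A ∩ Icc ((k : ℕ) + 1) (k + M)).ncard : ℝ) / M) ∈ Icc (0 : ℝ) 1 :=
  ⟨Real.iSup_nonneg fun k => (ncard_window_div_mem A k M).1,
    ciSup_le fun k => (ncard_window_div_mem A k M).2⟩

/-- The families under consideration are closed under enlarging a set and under removing an
initial segment. -/
theorem mem_family_of_tail_subset {𝒜 : Set (Set ℕ)}
    (h𝒜 : 𝒜 = infiniteSets ∨ 𝒜 = posUpperBanachDens ∨ 𝒜 = posUpperDens ∨ 𝒜 = posLowerDens)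
    {A B : Set ℕ} (hA : A ∈ 𝒜) {n₀ : ℕ} (h : A ∩ Ici n₀ ⊆ B) : B ∈ 𝒜 := by
  have key : ∀ a b M : ℕ, ((A ∩ Icc a b).ncard : ℝ) / M ≤
      ((B ∩ Icc a b).ncard : ℝ) / M + n₀ / M := fun a b M => by
    rw [← add_div]
    gcongr
    exact_mod_cast ncard_inter_le_add h a b
  rcases h𝒜 with rfl | rfl | rfl | rfl
  · refine Set.Infinite.mono h ?_
    have h1 : A ⊆ (A ∩ Ici n₀) ∪ Iio n₀ := fun x hx =>
      (lt_or_ge x n₀).elim (fun h' => Or.inr h') fun h' => Or.inl ⟨hx, h'⟩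
    intro hfin
    exact hA ((hfin.union (finite_Iio n₀)).subset h1)
  · refine limsup_pos_of_le_add_div (C := n₀) (iSup_window_mem A) (iSup_window_mem B) ?_ hA
    refine fun M => ciSup_le fun k => (key _ _ _).trans ?_
    gcongr
    exact le_ciSup (f := fun k : ℕ+ => ((B ∩ Icc ((k : ℕ) + 1) (k + M)).ncard : ℝ) / M)
      ⟨1, forall_mem_range.2 fun k => (ncard_window_div_mem B k M).2⟩ k
  · exact limsup_pos_of_le_add_div (C := n₀) (ncard_Icc_one_div_mem A) (ncard_Icc_one_div_mem B)
      (fun M => key _ _ _) hA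
  · exact liminf_pos_of_le_add_div (C := n₀) (ncard_Icc_one_div_mem A) (ncard_Icc_one_div_mem B)
      (fun M => key _ _ _) hA

theorem infinite_of_mem_family {𝒜 : Set (Set ℕ)}
    (h𝒜 : 𝒜 = infiniteSets ∨ 𝒜 = posUpperBanachDens ∨ 𝒜 = posUpperDens ∨ 𝒜 = posLowerDens)
    {A : Set ℕ} (hA : A ∈ 𝒜) : A.Infinite := by
  intro hfin
  obtain ⟨b, hb⟩ := hfin.bddAbove
  -- A finite set has an empty tail, but the empty set is finite and has density zero in every
  -- sense.
  have hempty : (∅ : Set ℕ) ∈ 𝒜 := mem_family_of_tail_subset h𝒜 hA (n₀ := b + 1) fun n hn =>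
    absurd (hb hn.1) (not_le.2 hn.2)
  rcases h𝒜 with rfl | rfl | rfl | rfl
  · exact hempty finite_empty
  · simp [posUpperBanachDens, upperBanachDens] at hempty
  · simp [posUpperDens, upperDens] at hempty
  · simp [posLowerDens, lowerDens] at hempty

/-! ### Null sequences and pseudo-shifts -/

section
variable {𝕜 : Type*} [RCLike 𝕜]

theorem c0_norm_le {x : C₀(ℕ+, 𝕜)} {r : ℝ} (hr : 0 ≤ r) (h : ∀ i, ‖x i‖ ≤ r) : ‖x‖ ≤ r := by
  rw [← ZeroAtInftyContinuousMap.norm_toBCF_eq_norm]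
  exact (BoundedContinuousFunction.norm_le hr).2 h

theorem c0_norm_apply_le (x : C₀(ℕ+, 𝕜)) (i : ℕ+) : ‖x i‖ ≤ ‖x‖ := by
  rw [← ZeroAtInftyContinuousMap.norm_toBCF_eq_norm]
  exact x.toBCF.norm_coe_le_norm i

theorem exists_c0_of_tendsto {g : ℕ+ → 𝕜} (hg : Tendsto g cofinite (𝓝 0)) :
    ∃ x : C₀(ℕ+, 𝕜), ∀ i, x i = g i :=
  ⟨{ toFun := g
     continuous_toFun := continuous_of_discreteTopology
     zero_at_infty' := by rwa [cocompact_eq_cofinite] }, fun _ => rfl⟩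

theorem exists_c0_truncation (g : ℕ+ → 𝕜) (l : ℕ+) :
    ∃ x : C₀(ℕ+, 𝕜), (∀ i ≤ l, x i = g i) ∧ ∀ i, l < i → x i = 0 := by
  obtain ⟨x, hx⟩ := exists_c0_of_tendsto (g := fun i => if i ≤ l then g i else 0) (by
    refine tendsto_nhds_of_eventually_eq ?_
    filter_upwards [(finite_Iic l).compl_mem_cofinite] with i hi
    exact if_neg hi)
  exact ⟨x, fun i hi => (hx i).trans (if_pos hi), fun i hi => (hx i).trans (if_neg hi.not_ge)⟩

theorem c0_tendsto_cofinite (x : C₀(ℕ+, 𝕜)) : Tendsto x cofinite (𝓝 0) := by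
  have := zero_at_infty x
  rwa [cocompact_eq_cofinite] at this

theorem pseudoShift_pow_apply (f : ℕ+ → ℕ+) (hf : StrictMono f) (w : ℕ+ → 𝕜)
    (hw : ∃ C : ℝ, ∀ j, ‖w (f j)‖ ≤ C) (n : ℕ) (x : C₀(ℕ+, 𝕜)) (j : ℕ+) :
    (pseudoShift f hf w hw ^ n) x j = weightProd f w j n * x (f^[n] j) := by
  induction n generalizing x with
  | zero => simp [weightProd]
  | succ n ih =>
    rw [pow_succ, mul_apply_eq_comp, ih, pseudoShift_apply, weightProd, weightProd,
      Finset.prod_Icc_succ_top (by omega), Function.iterate_succ_apply']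
    ring

theorem piMap_pow_apply {X : Type*} [NormedAddCommGroup X] [NormedSpace 𝕜 X] {N : ℕ}
    (T : Fin N → X →L[𝕜] X) (n : ℕ) (x : Fin N → X) (s : Fin N) :
    (ContinuousLinearMap.piMap T ^ n) x s = (T s ^ n) (x s) := by
  induction n generalizing x with
  | zero => simp
  | succ n ih => rw [pow_succ, pow_succ, mul_apply_eq_comp, ih]; rfl

theorem weightProd_ne_zero_of_le {f : ℕ+ → ℕ+} {w : ℕ+ → 𝕜} {j : ℕ+} {m n : ℕ} (hmn : m ≤ n)
    (h : weightProd f w j n ≠ 0) : weightProd f w j m ≠ 0 := by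
  rw [weightProd, Finset.prod_ne_zero_iff] at h ⊢
  exact fun ν hν => h ν (Finset.Icc_subset_Icc_right hmn hν)

/-- Strict monotonicity and `1 < f 1` give `i < f i` for all `i`, so the orbit of `j` is strictly
increasing. -/
theorem tendsto_iterate_cofinite {f : ℕ+ → ℕ+} (hf : StrictMono f) (hf1 : 1 < f 1) (j : ℕ+) :
    Tendsto (fun n => f^[n] j) atTop cofinite := by
  have hlt : ∀ i, i < f i := by
    intro i
    induction i using PNat.recOn with
    | one => exact hf1
    | succ i ih => exact (PNat.add_one_le_iff.2 ih).trans_lt (hf (PNat.lt_add_right i 1))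
  have hm : StrictMono fun n => f^[n] j := strictMono_nat_of_lt_succ fun n => by
    rw [Function.iterate_succ_apply']
    exact hlt _
  rw [← Nat.cofinite_eq_atTop]
  exact hm.injective.tendsto_cofinite

/-- The factor `z` is the coordinate of `x` shared by two colliding indices; the lower bound forces
`z ≠ 0`, and it cancels. -/
theorem norm_div_norm_le_of_mul {a b z : 𝕜} {u v : ℝ} (hv : 0 < v) (ha : ‖a * z‖ ≤ u)
    (hb : v ≤ ‖b * z‖) : ‖a‖ / ‖b‖ ≤ u / v := by
  have hz : ‖z‖ ≠ 0 := by
    intro h0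
    rw [norm_mul, h0, mul_zero] at hb
    linarith
  rw [← mul_div_mul_right ‖a‖ ‖b‖ hz, ← norm_mul, ← norm_mul]
  exact div_le_div₀ ((norm_nonneg _).trans ha) ha hv hb

/-- A sequence of nowhere vanishing arrays that approximates every array on every initial segment
infinitely often. -/
theorem exists_dense_arrays (𝕜 : Type*) [RCLike 𝕜] (N : ℕ) :
    ∃ (l : ℕ → ℕ+) (d : ℕ → Fin N → ℕ+ → 𝕜), (∀ r s i, d r s i ≠ 0) ∧
      ∀ (l₀ : ℕ+) (a : Fin N → ℕ+ → 𝕜) (δ : ℝ), 0 < δ → ∀ R : ℕ, ∃ r, R ≤ r ∧ l r = l₀ ∧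
        ∀ s, ∀ i ≤ l₀, ‖d r s i - a s i‖ < δ := by
  -- The last factor is a dummy label: one index for each label yields infinitely many distinct
  -- indices.
  let Q := ℕ+ × (Fin N → ℕ+ → ({0}ᶜ : Set 𝕜)) × ℕ
  have : Nonempty ({0}ᶜ : Set 𝕜) := ⟨⟨1, by simp⟩⟩
  refine ⟨fun r => (TopologicalSpace.denseSeq Q r).1,
    fun r s i => (TopologicalSpace.denseSeq Q r).2.1 s i,
    fun r s i => ((TopologicalSpace.denseSeq Q r).2.1 s i).2, fun l₀ a δ hδ R => ?_⟩
  have hex : ∀ s i, ∃ b : ({0}ᶜ : Set 𝕜), ‖(b : 𝕜) - a s i‖ < δ := by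
    intro s i
    obtain ⟨b, hb, hb'⟩ := (dense_compl_singleton (0 : 𝕜)).exists_dist_lt (a s i) hδ
    exact ⟨⟨b, hb⟩, by rwa [← dist_eq_norm, dist_comm]⟩
  choose b hb using hex
  have hopen : IsOpen {d : Fin N → ℕ+ → ({0}ᶜ : Set 𝕜) |
      ∀ s, ∀ i ∈ Iic l₀, ‖(d s i : 𝕜) - a s i‖ < δ} := by
    simp only [ofPred_forall]
    refine isOpen_iInter_of_finite fun s => (finite_Iic l₀).isOpen_biInter fun i _ => ?_
    exact isOpen_lt (by fun_prop) continuous_const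
  have hr : ∀ m : ℕ, ∃ r, (TopologicalSpace.denseSeq Q r).1 = l₀ ∧
      (∀ s, ∀ i ∈ Iic l₀, ‖((TopologicalSpace.denseSeq Q r).2.1 s i : 𝕜) - a s i‖ < δ) ∧
      (TopologicalSpace.denseSeq Q r).2.2 = m := by
    intro m
    obtain ⟨_, ⟨h1, h2, h3⟩, r, rfl⟩ := (TopologicalSpace.denseRange_denseSeq Q).inter_open_nonempty
      (({l₀} : Set ℕ+) ×ˢ ({d : Fin N → ℕ+ → ({0}ᶜ : Set 𝕜) |
        ∀ s, ∀ i ∈ Iic l₀, ‖(d s i : 𝕜) - a s i‖ < δ} ×ˢ ({m} : Set ℕ)))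
      ((isOpen_discrete _).prod (hopen.prod (isOpen_discrete _)))
      ⟨(l₀, b, m), rfl, fun s i _ => hb s i, rfl⟩
    exact ⟨r, h1, h2, h3⟩
  choose r h1 h2 h3 using hr
  have hinj : Function.Injective r := fun m m' h => by rw [← h3 m, ← h3 m', h]
  obtain ⟨m, hm⟩ := ((Nat.cofinite_eq_atTop ▸ hinj.tendsto_cofinite :
    Tendsto r atTop atTop).eventually_ge_atTop R).exists
  exact ⟨r m, hm, h1 m, h2 m⟩

end

section
variable {𝕜 : Type*} [RCLike 𝕜]

/-! ### Necessity -/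

theorem exists_scale {N : ℕ} {d : Fin N → ℕ+ → 𝕜} (hd : ∀ s i, d s i ≠ 0) (L : ℕ+) (K : ℝ) :
    ∃ M : ℝ, 1 ≤ M ∧ ∀ s, ∀ i ≤ L, K ≤ M * ‖d s i‖ := by
  have h : ∀ᶠ M : ℝ in atTop, ∀ s, ∀ i ∈ Iic L, K ≤ M * ‖d s i‖ :=
    eventually_all.2 fun s => (eventually_all_finite (finite_Iic L)).2 fun i _ =>
      (tendsto_id.atTop_mul_const (norm_pos_iff.2 (hd s i))).eventually_ge_atTop K
  exact ((eventually_ge_atTop 1).and h).exists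

theorem exists_uniform_div_close {N : ℕ} (l : ℕ+) {a : Fin N → ℕ+ → 𝕜}
    (ha : ∀ s, ∀ j ≤ l, a s j ≠ 0) {δ : ℝ} (hδ : 0 < δ) :
    ∃ ρ : ℝ, 0 < ρ ∧ ∀ s t : Fin N, ∀ i ≤ l, ∀ p ≤ l, ∀ u v : 𝕜, ‖u - a s i‖ < ρ →
      ‖v - a t p‖ < ρ → ‖u / v - a s i / a t p‖ ≤ δ := by
  have h : ∀ᶠ ρ : ℝ in 𝓝[>] 0, ∀ s t : Fin N, ∀ i ∈ Iic l, ∀ p ∈ Iic l, ∀ u v : 𝕜,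
      ‖u - a s i‖ < ρ → ‖v - a t p‖ < ρ → ‖u / v - a s i / a t p‖ ≤ δ := by
    refine eventually_all.2 fun s => eventually_all.2 fun t =>
      (eventually_all_finite (finite_Iic l)).2 fun i _ =>
      (eventually_all_finite (finite_Iic l)).2 fun p hp => ?_
    have hc : ContinuousAt (fun q : 𝕜 × 𝕜 => q.1 / q.2) (a s i, a t p) :=
      continuousAt_fst.div continuousAt_snd (ha t p hp)
    obtain ⟨ρ₀, hρ₀, h⟩ := Metric.continuousAt_iff.1 hc δ hδ
    filter_upwards [Ioo_mem_nhdsGT hρ₀] with ρ hρ u v hu hv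
    have := h (x := (u, v)) (by
      rw [Prod.dist_eq, dist_eq_norm, dist_eq_norm]
      exact max_lt (hu.trans hρ.2) (hv.trans hρ.2))
    rw [dist_eq_norm] at this
    exact this.le
  obtain ⟨ρ, hρ, h⟩ := ((eventually_mem_nhdsWithin (s := Ioi (0 : ℝ))).and h).exists
  exact ⟨ρ, hρ, h⟩

theorem exists_sets_of_disjointHypercyclic {N : ℕ}
    {f : Fin N → ℕ+ → ℕ+} (hf : ∀ s, StrictMono (f s)) (hf1 : ∀ s, 1 < f s 1)
    {w : Fin N → ℕ+ → 𝕜} (hw : ∀ s, ∃ C : ℝ, ∀ j, ‖w s (f s j)‖ ≤ C)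
    {𝒜 : Set (Set ℕ)}
    (h : DisjointHypercyclic 𝒜 (fun s => pseudoShift (f s) (hf s) (w s) (hw s))) :
    ∃ (A : ℕ+ → Set ℕ) (ε : ℕ+ → ℝ),
      (∀ k, A k ∈ 𝒜) ∧ (∀ k, 0 < ε k) ∧ Tendsto ε atTop (𝓝 0) ∧
      (∀ j k : ℕ+, j ≤ k → ∀ s : Fin N,
        Tendsto (fun n => ‖weightProd (f s) (w s) j n‖) (atTop ⊓ 𝓟 (A k)) atTop) ∧
      (∀ l k : ℕ+, ∀ n ∈ A l, ∀ m ∈ A k, ∀ s : Fin N, ∀ i p : ℕ+, l < i → p ≤ k →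
        (f s)^[n] i = (f s)^[m] p →
          ‖weightProd (f s) (w s) i n‖ / ‖weightProd (f s) (w s) p m‖ ≤ min (ε l) (ε k)) ∧
      (∀ j l k : ℕ+, j ≤ l → ∀ n ∈ A k, ∀ s t : Fin N, s ≠ t → ∀ m ∈ A l, m ≠ n →
        ∀ i : ℕ+, k < i → (f s)^[n] i = (f t)^[m] j →
          ‖weightProd (f s) (w s) i n‖ / ‖weightProd (f t) (w t) j m‖ ≤ ε l) ∧
      (∀ j k l : ℕ+, j ≤ k → k < l → ∀ n ∈ A l, ∀ s t : Fin N, s ≠ t → ∀ m ∈ A k,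
        ∀ i : ℕ+, l < i → (f s)^[n] i = (f t)^[m] j →
          ‖weightProd (f s) (w s) i n‖ / ‖weightProd (f t) (w t) j m‖ ≤ ε l) ∧
      (∀ (l : ℕ+) (a : Fin N → ℕ+ → 𝕜), (∀ s, ∀ j ≤ l, a s j ≠ 0) → ∀ δ : ℝ, 0 < δ →
        ∃ L : ℕ+, l ≤ L ∧ ∀ s t : Fin N, s ≠ t → ∀ n ∈ A L,
          (∀ i p : ℕ+, i ≤ l → p ≤ l → (f s)^[n] i = (f t)^[n] p →
            ‖weightProd (f s) (w s) i n / weightProd (f t) (w t) p n - a s i / a t p‖ ≤ δ) ∧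
          (∀ i p : ℕ+, l < i → p ≤ l → (f s)^[n] i = (f t)^[n] p →
            ‖weightProd (f s) (w s) i n‖ / ‖weightProd (f t) (w t) p n‖ ≤ δ)) := by
  obtain ⟨x, hx⟩ := h
  obtain ⟨l, d, hd, hdense⟩ := exists_dense_arrays 𝕜 N
  have hL1 : ∀ L : ℕ+, (1 : ℝ) ≤ (L : ℕ) := fun L => by exact_mod_cast L.pos
  -- The order `L ^ 2` is needed for the last condition, where a numerator of order `L` must be
  -- divided down to `1 / L`.
  choose M hM1 hM using fun L : ℕ+ => exists_scale (hd L) L (4 * ((L : ℕ) : ℝ) ^ 2)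
  -- The filler `L` between `l L` and `L` is large enough for the first three conditions, yet small
  -- against `4 * L ^ 2`.
  choose y hy hy0 using fun (L : ℕ+) (s : Fin N) =>
    exists_c0_truncation (fun i => if i ≤ l L then (M L : 𝕜) * d L s i else ((L : ℕ) : 𝕜)) L
  let A : ℕ+ → Set ℕ := fun L => {n | (ContinuousLinearMap.piMap
    (fun s => pseudoShift (f s) (hf s) (w s) (hw s)) ^ n) (fun _ : Fin N => x) ∈
      Metric.ball (y L) (1 / (2 * (L : ℕ)))}
  have hη : ∀ L : ℕ+, (0 : ℝ) < 1 / (2 * (L : ℕ)) := fun L => by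
    have := hL1 L
    positivity
  have hη2 : ∀ L : ℕ+, (1 : ℝ) / (2 * (L : ℕ)) ≤ 1 / 2 := fun L => by
    have := hL1 L
    gcongr
    linarith
  have hA : ∀ L, A L ∈ 𝒜 := fun L => hx _ Metric.isOpen_ball ⟨y L, Metric.mem_ball_self (hη L)⟩
  have hclose : ∀ L, ∀ n ∈ A L, ∀ s i,
      ‖weightProd (f s) (w s) i n * x ((f s)^[n] i) - y L s i‖ ≤ 1 / (2 * (L : ℕ)) := by
    intro L n hn s i
    have h1 := (norm_le_pi_norm _ s).trans (mem_ball_iff_norm.1 hn).le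
    rw [Pi.sub_apply, piMap_pow_apply] at h1
    have h2 := (c0_norm_apply_le _ i).trans h1
    rwa [ZeroAtInftyContinuousMap.sub_apply, pseudoShift_pow_apply] at h2
  have hnum : ∀ L, ∀ n ∈ A L, ∀ s i, L < i →
      ‖weightProd (f s) (w s) i n * x ((f s)^[n] i)‖ ≤ 1 / (2 * (L : ℕ)) := by
    intro L n hn s i hi
    simpa [hy0 L s i hi] using hclose L n hn s i
  have hylow : ∀ (L : ℕ+) s i, i ≤ L → ((L : ℕ) : ℝ) ≤ ‖y L s i‖ := by
    intro L s i hi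
    rw [hy L s i hi]
    split_ifs
    · rw [norm_mul, RCLike.norm_ofReal, abs_of_nonneg (zero_le_one.trans (hM1 L))]
      refine le_trans ?_ (hM L s i hi)
      nlinarith [hL1 L]
    · rw [RCLike.norm_natCast]
  have hden : ∀ L, ∀ n ∈ A L, ∀ s i, i ≤ L →
      ((L : ℕ) : ℝ) / 2 ≤ ‖weightProd (f s) (w s) i n * x ((f s)^[n] i)‖ := by
    intro L n hn s i hi
    have h1 := norm_sub_norm_le (y L s i) (weightProd (f s) (w s) i n * x ((f s)^[n] i))
    rw [norm_sub_rev] at h1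
    linarith [hclose L n hn s i, hylow L s i hi, hη2 L, hL1 L]
  -- Numerator at most `1 / (2 * l)`, denominator at least `k / 2`: the product bound lies below
  -- both `1 / l` and `1 / k`, so it serves conditions 1 to 3 at once.
  have hratio : ∀ l k : ℕ+, ∀ n ∈ A l, ∀ m ∈ A k, ∀ s t : Fin N, ∀ i p : ℕ+, l < i → p ≤ k →
      (f s)^[n] i = (f t)^[m] p →
      ‖weightProd (f s) (w s) i n‖ / ‖weightProd (f t) (w t) p m‖ ≤
        (1 / ((l : ℕ) : ℝ)) * (1 / (k : ℕ)) := by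
    intro l k n hn m hm s t i p hi hp hip
    have hk := hL1 k
    have hl := hL1 l
    have h1 := hnum l n hn s i hi
    rw [hip] at h1
    refine (norm_div_norm_le_of_mul (by linarith) h1 (hden k m hm t p hp)).trans (le_of_eq ?_)
    field_simp
  have hinv : ∀ k : ℕ+, 0 < 1 / ((k : ℕ) : ℝ) ∧ 1 / ((k : ℕ) : ℝ) ≤ 1 := fun k => by
    have := hL1 k
    exact ⟨by positivity, by rw [div_le_one (by linarith)]; exact this⟩
  have hmulr : ∀ l k : ℕ+, (1 / ((l : ℕ) : ℝ)) * (1 / (k : ℕ)) ≤ 1 / ((k : ℕ) : ℝ) := fun l k =>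
    mul_le_of_le_one_left (hinv k).1.le (hinv l).2
  have hmull : ∀ l k : ℕ+, (1 / ((l : ℕ) : ℝ)) * (1 / (k : ℕ)) ≤ 1 / ((l : ℕ) : ℝ) := fun l k =>
    mul_le_of_le_one_right (hinv l).1.le (hinv k).2
  have hcoe : Tendsto (fun k : ℕ+ => ((k : ℕ) : ℝ)) atTop atTop :=
    tendsto_natCast_atTop_atTop.comp tendsto_PNat_val_atTop_atTop
  refine ⟨A, fun k => 1 / (k : ℕ), hA, fun k => (hinv k).1, ?_, ?_, ?_, ?_, ?_, ?_⟩
  · exact tendsto_const_nhds.div_atTop hcoe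
  · intro j k hjk s
    -- The weight product must blow up, since the coordinates of `x` vanish at infinity while the
    -- product of the two stays at least `1 / 2`.
    have hx0 : Tendsto (fun n => ‖x ((f s)^[n] j)‖) (atTop ⊓ 𝓟 (A k)) (𝓝 0) := by
      have := ((c0_tendsto_cofinite x).comp (tendsto_iterate_cofinite (hf s) (hf1 s) j)).norm
      rw [norm_zero] at this
      exact this.mono_left inf_le_left
    have hne : ∀ᶠ n in atTop ⊓ 𝓟 (A k), (1 / 2 : ℝ) ≤
        ‖weightProd (f s) (w s) j n‖ * ‖x ((f s)^[n] j)‖ := by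
      filter_upwards [mem_inf_of_right (mem_principal_self (A k))] with n hn
      rw [← norm_mul]
      linarith [hden k n hn s j hjk, hL1 k]
    have hpos : Tendsto (fun n => ‖x ((f s)^[n] j)‖) (atTop ⊓ 𝓟 (A k)) (𝓝[>] 0) :=
      tendsto_nhdsWithin_iff.2 ⟨hx0, hne.mono fun n hn =>
        pos_of_mul_pos_right (lt_of_lt_of_le (by norm_num) hn) (norm_nonneg _)⟩
    refine tendsto_atTop_mono' _ ?_
      ((tendsto_inv_nhdsGT_zero.comp hpos).const_mul_atTop (by norm_num : (0 : ℝ) < 1 / 2))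
    filter_upwards [hne, hpos.eventually self_mem_nhdsWithin] with n h1 h2
    exact (mul_inv_le_iff₀ h2).2 h1
  · intro l k n hn m hm s i p hi hp hip
    have := hratio l k n hn m hm s s i p hi hp hip
    exact le_min (this.trans (hmull l k)) (this.trans (hmulr l k))
  · intro j l k hjl n hn s t _ m hm _ i hi hij
    exact (hratio k l n hn m hm s t i j hi hjl hij).trans (hmulr k l)
  · intro j k l hjk _ n hn s t _ m hm i hi hij
    exact (hratio l k n hn m hm s t i j hi hjk hij).trans (hmull l k)
  · intro l₀ a ha δ hδ
    obtain ⟨ρ, hρ, hclosediv⟩ := exists_uniform_div_close l₀ ha hδ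
    obtain ⟨R, hR⟩ := exists_nat_gt (max (1 / δ) (2 / ρ))
    obtain ⟨r, hr, hlr, hdr⟩ := hdense l₀ a (ρ / 2) (half_pos hρ) (max R (l₀ : ℕ))
    -- The position of the array in the dense sequence is itself the required index `L`.
    obtain ⟨L, rfl⟩ : ∃ L : ℕ+, (L : ℕ) = r :=
      ⟨⟨r, l₀.pos.trans_le ((le_max_right _ _).trans hr)⟩, rfl⟩
    have hRL : (R : ℝ) ≤ (L : ℕ) := by exact_mod_cast (le_max_left _ _).trans hr
    have hl₀L : l₀ ≤ L := PNat.coe_le_coe _ _ |>.1 ((le_max_right _ _).trans hr)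
    have hLpos : (0 : ℝ) < (L : ℕ) := zero_lt_one.trans_le (hL1 L)
    have hLδ : 1 / ((L : ℕ) : ℝ) ≤ δ := by
      rw [one_div_le hLpos hδ]
      exact (((le_max_left _ _).trans_lt hR).trans_le hRL).le
    have hLρ : 1 / (2 * ((L : ℕ) : ℝ)) < ρ / 2 := by
      have : 2 / ρ < (L : ℕ) := ((le_max_right _ _).trans_lt hR).trans_le hRL
      rw [div_lt_iff₀ hρ] at this
      rw [div_lt_iff₀ (by positivity)]
      nlinarith
    have hM0 : 0 < M L := zero_lt_one.trans_le (hM1 L)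
    have hM0' : (M L : 𝕜) ≠ 0 := by exact_mod_cast hM0.ne'
    have hyd : ∀ s, ∀ i ≤ l₀, y L s i = M L * d L s i := fun s i hi => by
      rw [hy L s i (hi.trans hl₀L), hlr, if_pos hi]
    refine ⟨L, hl₀L, fun s t _ n hn => ⟨fun i p hi hp hip => ?_, fun i p hi hp hip => ?_⟩⟩
    · have hnear : ∀ s, ∀ i ≤ l₀,
          ‖weightProd (f s) (w s) i n * x ((f s)^[n] i) / M L - a s i‖ < ρ := by
        intro s i hi
        have h1 : ‖weightProd (f s) (w s) i n * x ((f s)^[n] i) / M L - d L s i‖ ≤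
            1 / (2 * (L : ℕ)) := by
          have h2 := hclose L n hn s i
          rw [hyd s i hi] at h2
          have h3 : weightProd (f s) (w s) i n * x ((f s)^[n] i) / M L - d L s i =
              (weightProd (f s) (w s) i n * x ((f s)^[n] i) - M L * d L s i) / M L := by
            field_simp
          rw [h3, norm_div, RCLike.norm_ofReal, abs_of_pos hM0]
          exact (div_le_self (norm_nonneg _) (hM1 L)).trans h2
        linarith [norm_sub_le_norm_sub_add_norm_sub
          (weightProd (f s) (w s) i n * x ((f s)^[n] i) / M L) (d L s i) (a s i), hdr s i hi]
      have h1 := hclosediv s t i hi p hp _ _ (hnear s i hi) (hnear t p hp)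
      have hz : x ((f t)^[n] p) ≠ 0 := by
        intro h0
        have := hden L n hn t p (hp.trans hl₀L)
        rw [h0, mul_zero, norm_zero] at this
        linarith
      rwa [hip, div_div_div_cancel_right₀ hM0', mul_div_mul_right _ _ hz] at h1
    -- Since `l L = l₀ < i`, the target at `i` is either the filler `L` or `0`.
    · have hyi : ‖y L s i‖ ≤ (L : ℕ) := by
        rcases le_or_gt i L with hiL | hiL
        · rw [hy L s i hiL, hlr, if_neg hi.not_ge, RCLike.norm_natCast]
        · rw [hy0 L s i hiL, norm_zero]
          exact hLpos.le
      have hu : ‖weightProd (f s) (w s) i n * x ((f s)^[n] i)‖ ≤ 2 * (L : ℕ) := by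
        have h1 := norm_le_norm_add_norm_sub' (weightProd (f s) (w s) i n * x ((f s)^[n] i))
          (y L s i)
        linarith [hclose L n hn s i, hη2 L, hL1 L]
      have hv : 2 * ((L : ℕ) : ℝ) ^ 2 ≤ ‖weightProd (f t) (w t) p n * x ((f t)^[n] p)‖ := by
        have h1 := norm_sub_norm_le (y L t p) (weightProd (f t) (w t) p n * x ((f t)^[n] p))
        rw [norm_sub_rev] at h1
        have h2 : 4 * ((L : ℕ) : ℝ) ^ 2 ≤ ‖y L t p‖ := by
          rw [hyd t p hp, norm_mul, RCLike.norm_ofReal, abs_of_pos hM0]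
          exact hM L t p (hp.trans hl₀L)
        nlinarith [hclose L n hn t p, hη2 L, hL1 L]
      rw [hip] at hu
      refine (norm_div_norm_le_of_mul (by positivity) hu hv).trans (le_trans (le_of_eq ?_) hLδ)
      field_simp

end

section
variable {𝕜 : Type*} [RCLike 𝕜]

/-! ### Sufficiency -/

/-- In the last condition of the characterization, the index `L` may be taken arbitrarily large. -/
theorem exists_large_index_of_ratio_approx {N : ℕ} {f : Fin N → ℕ+ → ℕ+} {w : Fin N → ℕ+ → 𝕜}
    {A : ℕ+ → Set ℕ}
    (h : ∀ (l : ℕ+) (a : Fin N → ℕ+ → 𝕜), (∀ s, ∀ j ≤ l, a s j ≠ 0) → ∀ δ : ℝ, 0 < δ →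
      ∃ L : ℕ+, l ≤ L ∧ ∀ s t : Fin N, s ≠ t → ∀ n ∈ A L,
        (∀ i p : ℕ+, i ≤ l → p ≤ l → (f s)^[n] i = (f t)^[n] p →
          ‖weightProd (f s) (w s) i n / weightProd (f t) (w t) p n - a s i / a t p‖ ≤ δ) ∧
        (∀ i p : ℕ+, l < i → p ≤ l → (f s)^[n] i = (f t)^[n] p →
          ‖weightProd (f s) (w s) i n‖ / ‖weightProd (f t) (w t) p n‖ ≤ δ))
    (l l' : ℕ+) {a : Fin N → ℕ+ → 𝕜} (ha : ∀ s j, a s j ≠ 0) {δ : ℝ} (hδ : 0 < δ) :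
    ∃ L : ℕ+, l' ≤ L ∧ ∀ s t : Fin N, s ≠ t → ∀ n ∈ A L,
      (∀ i p : ℕ+, i ≤ l → p ≤ l → (f s)^[n] i = (f t)^[n] p →
        ‖weightProd (f s) (w s) i n / weightProd (f t) (w t) p n - a s i / a t p‖ ≤ δ) ∧
      (∀ i p : ℕ+, l < i → p ≤ l → (f s)^[n] i = (f t)^[n] p →
        ‖weightProd (f s) (w s) i n‖ / ‖weightProd (f t) (w t) p n‖ ≤ δ) := by
  have hτ : ∀ᶠ τ : ℝ in 𝓝[>] 0, ∀ t, ∀ p ∈ Iic l, τ ≤ δ / 2 * ‖a t p‖ :=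
    eventually_all.2 fun t => (eventually_all_finite (finite_Iic l)).2 fun p _ => by
      filter_upwards [Ioo_mem_nhdsGT (mul_pos (half_pos hδ) (norm_pos_iff.2 (ha t p)))] with τ hτ
        using hτ.2.le
  obtain ⟨τ, hτ0, hτ⟩ := ((eventually_mem_nhdsWithin (s := Ioi (0 : ℝ))).and hτ).exists
  have hτ0 : 0 < τ := hτ0
  -- Entries past `l` are set to a tiny `τ`, so prescribing ratios up to `max l l'` makes those with
  -- `l < i` small, as the second clause demands.
  obtain ⟨L, hL, hLA⟩ := h (max l l') (fun s i => if i ≤ l then a s i else (τ : 𝕜))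
    (fun s j _ => by
      split_ifs
      · exact ha s j
      · exact_mod_cast hτ0.ne') (δ / 2) (half_pos hδ)
  refine ⟨L, (le_max_right _ _).trans hL, fun s t hst n hn => ⟨fun i p hi hp hip => ?_,
    fun i p hi hp hip => ?_⟩⟩
  · have := (hLA s t hst n hn).1 i p (hi.trans (le_max_left _ _)) (hp.trans (le_max_left _ _)) hip
    rw [if_pos hi, if_pos hp] at this
    linarith
  · rcases le_or_gt i (max l l') with hi' | hi'
    · have h1 := (hLA s t hst n hn).1 i p hi' (hp.trans (le_max_left _ _)) hip
      rw [if_neg hi.not_ge, if_pos hp] at h1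
      have h2 : ‖(τ : 𝕜) / a t p‖ ≤ δ / 2 := by
        rw [norm_div, RCLike.norm_ofReal, abs_of_pos hτ0, div_le_iff₀ (norm_pos_iff.2 (ha t p))]
        exact hτ t p hp
      rw [← norm_div]
      linarith [norm_le_norm_add_norm_sub' (weightProd (f s) (w s) i n / weightProd (f t) (w t) p n)
        ((τ : 𝕜) / a t p)]
    · linarith [(hLA s t hst n hn).2 i p hi' (hp.trans (le_max_left _ _)) hip]

/-- Every `W_{j,m}` is a partial product of some nonzero `W_{j,n}` with `n ≥ m` in `A`. -/
theorem weightProd_ne_zero_of_tendsto {f : ℕ+ → ℕ+} {w : ℕ+ → 𝕜} {j : ℕ+} {A : Set ℕ}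
    (hA : A.Infinite) (h : Tendsto (fun n => ‖weightProd f w j n‖) (atTop ⊓ 𝓟 A) atTop) (m : ℕ) :
    weightProd f w j m ≠ 0 := by
  have h1 := h.eventually_gt_atTop 0
  rw [eventually_inf_principal] at h1
  obtain ⟨n, hn, hnA, hnm⟩ :=
    ((Nat.frequently_atTop_iff_infinite.2 hA).and_eventually
      (h1.and (eventually_ge_atTop m))).exists
  exact weightProd_ne_zero_of_le hnm (norm_pos_iff.1 (hnA hn))

/-- A null sequence whose coordinates at the points `f_t^n(p)`, for `n ∈ A_r` and `p ≤ l_r`, are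
the quotients `d_{r,t,p} / W^t_{p,n}` up to a choice at the coinciding points. -/
theorem exists_c0_of_quotients {N : ℕ} {f : Fin N → ℕ+ → ℕ+} {w : Fin N → ℕ+ → 𝕜}
    {l : ℕ → ℕ+} {d : ℕ → Fin N → ℕ+ → 𝕜} {A : ℕ → Set ℕ}
    (hsmall : ∀ r, ∀ n ∈ A r, ∀ t, ∀ p ≤ l r,
      ‖d r t p / weightProd (f t) (w t) p n‖ ≤ 1 / ((r : ℝ) + 1))
    (hlim : ∀ r t, ∀ p ≤ l r,
      Tendsto (fun n => ‖weightProd (f t) (w t) p n‖) (atTop ⊓ 𝓟 (A r)) atTop) :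
    ∃ x : C₀(ℕ+, 𝕜), ∀ j,
      (∃ r n t p, n ∈ A r ∧ p ≤ l r ∧ j = (f t)^[n] p ∧
        x j = d r t p / weightProd (f t) (w t) p n) ∨
      (x j = 0 ∧ ∀ r, ∀ n ∈ A r, ∀ t, ∀ p ≤ l r, j ≠ (f t)^[n] p) := by
  have hex : ∀ j, ∃ v : 𝕜,
      (∃ r n t p, n ∈ A r ∧ p ≤ l r ∧ j = (f t)^[n] p ∧
        v = d r t p / weightProd (f t) (w t) p n) ∨
      (v = 0 ∧ ∀ r, ∀ n ∈ A r, ∀ t, ∀ p ≤ l r, j ≠ (f t)^[n] p) := by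
    intro j
    by_cases h : ∃ r n t p, n ∈ A r ∧ p ≤ l r ∧ j = (f t)^[n] p
    · obtain ⟨r, n, t, p, hn, hp, hj⟩ := h
      exact ⟨_, Or.inl ⟨r, n, t, p, hn, hp, hj, rfl⟩⟩
    · exact ⟨0, Or.inr ⟨rfl, fun r n hn t p hp hj => h ⟨r, n, t, p, hn, hp, hj⟩⟩⟩
  choose g hg using hex
  obtain ⟨x, hx⟩ := exists_c0_of_tendsto (g := g) (by
    rw [Metric.tendsto_nhds]
    intro η hη
    obtain ⟨R, hR⟩ := exists_nat_one_div_lt hη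
    have hfin : ∀ r t, ∀ p ≤ l r,
        {n | n ∈ A r ∧ η ≤ ‖d r t p / weightProd (f t) (w t) p n‖}.Finite := by
      intro r t p hp
      have h1 : Tendsto (fun n => ‖d r t p / weightProd (f t) (w t) p n‖) (atTop ⊓ 𝓟 (A r))
          (𝓝 0) := by
        simp only [norm_div]
        exact tendsto_const_nhds.div_atTop (hlim r t p hp)
      have h2 := h1.eventually (gt_mem_nhds hη)
      rw [eventually_inf_principal] at h2
      obtain ⟨b, hb⟩ := eventually_atTop.1 h2
      refine (finite_Iio b).subset fun n hn => ?_
      by_contra hnb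
      exact (hb n (not_lt.1 hnb) hn.1).not_ge hn.2
    -- Coordinates of size at least `η` come only from `r < R`, and there from finitely many times,
    -- because the weight products diverge along `A r`.
    have hbig : (⋃ r ∈ Iio R, ⋃ t, ⋃ p ∈ Iic (l r), (fun n => (f t)^[n] p) ''
        {n | n ∈ A r ∧ η ≤ ‖d r t p / weightProd (f t) (w t) p n‖}).Finite :=
      (finite_Iio R).biUnion fun r _ => finite_iUnion fun t =>
        (finite_Iic (l r)).biUnion fun p hp => (hfin r t p hp).image _
    filter_upwards [hbig.compl_mem_cofinite] with j hj
    rw [dist_zero_right]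
    by_contra hlt
    rw [not_lt] at hlt
    rcases hg j with ⟨r, n, t, p, hn, hp, hjn, hv⟩ | ⟨h0, -⟩
    · rw [hv] at hlt
      have hrR : r < R := by
        by_contra hrR
        have h3 : (1 : ℝ) / (r + 1) ≤ 1 / (R + 1) := by
          have : (R : ℝ) ≤ r := by exact_mod_cast not_lt.1 hrR
          gcongr
        linarith [hsmall r n hn t p hp]
      refine hj ?_
      simp only [mem_iUnion]
      exact ⟨r, hrR, t, p, hp, n, ⟨hn, hlt⟩, hjn.symm⟩
    · rw [h0, norm_zero] at hlt
      exact hη.not_ge hlt)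
  refine ⟨x, fun j => ?_⟩
  rw [hx]
  exact hg j

/-- If the value at `f_s^n(i)` came from another time, disjointness forces `i > L r` and `hfar`
applies. At the same time the index `r` agrees; equal operators give equal positions, and different
ones are handled by `hnear` or `hmid`. -/
theorem exists_approximating_vector {N : ℕ} {f : Fin N → ℕ+ → ℕ+} (hf : ∀ s, StrictMono (f s))
    {w : Fin N → ℕ+ → 𝕜} {l L : ℕ → ℕ+} {d : ℕ → Fin N → ℕ+ → 𝕜} {A : ℕ → Set ℕ}
    (hlL : ∀ r, l r ≤ L r)
    (hW : ∀ s i n, weightProd (f s) (w s) i n ≠ 0)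
    (hdisj : ∀ r k, ∀ n ∈ A r, ∀ m ∈ A k, m ≠ n → ∀ s t, ∀ i ≤ L r, ∀ p ≤ L k,
      (f s)^[n] i ≠ (f t)^[m] p)
    (hAdisj : ∀ r k n, n ∈ A r → n ∈ A k → r = k)
    (hsmall : ∀ r, ∀ n ∈ A r, ∀ t, ∀ p ≤ l r,
      ‖d r t p / weightProd (f t) (w t) p n‖ ≤ 1 / ((r : ℝ) + 1))
    (hlim : ∀ r t, ∀ p ≤ l r,
      Tendsto (fun n => ‖weightProd (f t) (w t) p n‖) (atTop ⊓ 𝓟 (A r)) atTop)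
    (hfar : ∀ r k, ∀ n ∈ A r, ∀ m ∈ A k, ∀ s t, ∀ i > L r, ∀ p ≤ l k, m ≠ n →
      (f s)^[n] i = (f t)^[m] p →
      ‖weightProd (f s) (w s) i n‖ / ‖weightProd (f t) (w t) p m‖ * ‖d k t p‖ ≤ 1 / ((r : ℝ) + 1))
    (hnear : ∀ r, ∀ n ∈ A r, ∀ s t, s ≠ t → ∀ i ≤ l r, ∀ p ≤ l r, (f s)^[n] i = (f t)^[n] p →
      ‖weightProd (f s) (w s) i n / weightProd (f t) (w t) p n * d r t p - d r s i‖ ≤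
        1 / ((r : ℝ) + 1))
    (hmid : ∀ r, ∀ n ∈ A r, ∀ s t, s ≠ t → ∀ i > l r, ∀ p ≤ l r, (f s)^[n] i = (f t)^[n] p →
      ‖weightProd (f s) (w s) i n‖ / ‖weightProd (f t) (w t) p n‖ * ‖d r t p‖ ≤
        1 / ((r : ℝ) + 1)) :
    ∃ x : C₀(ℕ+, 𝕜), ∀ r, ∀ n ∈ A r, ∀ s i,
      (i ≤ l r → ‖weightProd (f s) (w s) i n * x ((f s)^[n] i) - d r s i‖ ≤ 1 / ((r : ℝ) + 1)) ∧
      (l r < i → ‖weightProd (f s) (w s) i n * x ((f s)^[n] i)‖ ≤ 1 / ((r : ℝ) + 1)) := by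
  obtain ⟨x, hx⟩ := exists_c0_of_quotients hsmall hlim
  have hpos : ∀ r : ℕ, (0 : ℝ) ≤ 1 / ((r : ℝ) + 1) := fun r => by positivity
  refine ⟨x, fun r n hn s i => ⟨fun hi => ?_, fun hi => ?_⟩⟩
  · rcases hx ((f s)^[n] i) with ⟨k, m, t, p, hm, hp, hj, hv⟩ | ⟨-, h0⟩
    · have hmn : m = n := by
        by_contra hmn
        exact hdisj r k n hn m hm hmn s t i (hi.trans (hlL r)) p (hp.trans (hlL k)) hj
      subst hmn
      obtain rfl := hAdisj r k m hn hm
      rw [hv, mul_div_left_comm, mul_comm]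
      by_cases hst : s = t
      · subst hst
        obtain rfl := ((hf s).injective.iterate m) hj
        rw [div_self (hW s i m), one_mul, sub_self, norm_zero]
        exact hpos r
      · exact hnear r m hn s t hst i hi p hp hj
    · exact absurd rfl (h0 r n hn s i hi)
  · rcases hx ((f s)^[n] i) with ⟨k, m, t, p, hm, hp, hj, hv⟩ | ⟨h0, -⟩
    · rw [hv, mul_div_left_comm, mul_comm, norm_mul, norm_div]
      by_cases hmn : m = n
      · subst hmn
        obtain rfl := hAdisj r k m hn hm
        by_cases hst : s = t
        · subst hst
          obtain rfl := ((hf s).injective.iterate m) hj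
          exact absurd hp hi.not_ge
        · exact hmid r m hn s t hst i hi p hp hj
      · rcases le_or_gt i (L r) with hiL | hiL
        · exact absurd hj (hdisj r k n hn m hm hmn s t i hiL p (hp.trans (hlL k)))
        · exact hfar r k n hn m hm s t i hiL p hp hmn hj
    · rw [h0, mul_zero, norm_zero]
      exact hpos r

theorem disjointHypercyclic_of_exists_sets {N : ℕ} (hN : 2 ≤ N)
    {f : Fin N → ℕ+ → ℕ+} (hf : ∀ s, StrictMono (f s))
    {w : Fin N → ℕ+ → 𝕜} (hw : ∀ s, ∃ C : ℝ, ∀ j, ‖w s (f s j)‖ ≤ C)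
    {𝒜 : Set (Set ℕ)}
    (h𝒜 : 𝒜 = infiniteSets ∨ 𝒜 = posUpperBanachDens ∨ 𝒜 = posUpperDens ∨ 𝒜 = posLowerDens)
    (hreg : WeaklyPartitionRegular f 𝒜) {A₀ : ℕ+ → Set ℕ} {ε : ℕ+ → ℝ}
    (hA₀ : ∀ k, A₀ k ∈ 𝒜) (hε : Tendsto ε atTop (𝓝 0))
    (h1 : ∀ j k : ℕ+, j ≤ k → ∀ s : Fin N,
        Tendsto (fun n => ‖weightProd (f s) (w s) j n‖) (atTop ⊓ 𝓟 (A₀ k)) atTop)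
    (h1' : ∀ l k : ℕ+, ∀ n ∈ A₀ l, ∀ m ∈ A₀ k, ∀ s : Fin N, ∀ i p : ℕ+, l < i → p ≤ k →
        (f s)^[n] i = (f s)^[m] p →
          ‖weightProd (f s) (w s) i n‖ / ‖weightProd (f s) (w s) p m‖ ≤ min (ε l) (ε k))
    (h2 : ∀ j l k : ℕ+, j ≤ l → ∀ n ∈ A₀ k, ∀ s t : Fin N, s ≠ t → ∀ m ∈ A₀ l, m ≠ n →
        ∀ i : ℕ+, k < i → (f s)^[n] i = (f t)^[m] j →
          ‖weightProd (f s) (w s) i n‖ / ‖weightProd (f t) (w t) j m‖ ≤ ε l)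
    (h3 : ∀ j k l : ℕ+, j ≤ k → k < l → ∀ n ∈ A₀ l, ∀ s t : Fin N, s ≠ t → ∀ m ∈ A₀ k,
        ∀ i : ℕ+, l < i → (f s)^[n] i = (f t)^[m] j →
          ‖weightProd (f s) (w s) i n‖ / ‖weightProd (f t) (w t) j m‖ ≤ ε l)
    (h4 : ∀ (l : ℕ+) (a : Fin N → ℕ+ → 𝕜), (∀ s, ∀ j ≤ l, a s j ≠ 0) → ∀ δ : ℝ, 0 < δ →
        ∃ L : ℕ+, l ≤ L ∧ ∀ s t : Fin N, s ≠ t → ∀ n ∈ A₀ L,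
          (∀ i p : ℕ+, i ≤ l → p ≤ l → (f s)^[n] i = (f t)^[n] p →
            ‖weightProd (f s) (w s) i n / weightProd (f t) (w t) p n - a s i / a t p‖ ≤ δ) ∧
          (∀ i p : ℕ+, l < i → p ≤ l → (f s)^[n] i = (f t)^[n] p →
            ‖weightProd (f s) (w s) i n‖ / ‖weightProd (f t) (w t) p n‖ ≤ δ)) :
    DisjointHypercyclic 𝒜 (fun s => pseudoShift (f s) (hf s) (w s) (hw s)) := by
  obtain ⟨A, hA, hAA₀, hAdisj⟩ := hreg A₀ hA₀
  have hW : ∀ s i n, weightProd (f s) (w s) i n ≠ 0 := fun s i =>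
    weightProd_ne_zero_of_tendsto (infinite_of_mem_family h𝒜 (hA₀ i)) (h1 i i le_rfl s)
  obtain ⟨l, d, hd, hdense⟩ := exists_dense_arrays 𝕜 N
  have hY : ∀ r, ∃ Y : ℝ, 0 < Y ∧ ∀ s, ∀ i ≤ l r, ‖d r s i‖ ≤ Y := by
    intro r
    have h : ∀ᶠ Y : ℝ in atTop, ∀ s, ∀ i ∈ Iic (l r), ‖d r s i‖ ≤ Y :=
      eventually_all.2 fun s => (eventually_all_finite (finite_Iic (l r))).2 fun i _ =>
        eventually_ge_atTop _
    exact ((eventually_gt_atTop 0).and h).exists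
  choose Y hY0 hY using hY
  have hr0 : ∀ r : ℕ, (0 : ℝ) < 1 / ((r : ℝ) + 1) := fun r => by positivity
  -- Ratio errors get multiplied by entries of size up to `Y r`, hence the division by `Y r`. The
  -- bound `ε K < 1` will make the chosen sets disjoint, and `ε K * Y k` with `k ≤ r` controls
  -- collisions with earlier arrays.
  let P : ℕ → ℕ+ → Prop := fun r K => l r ≤ K ∧ ε K < 1 ∧
    (∀ k ≤ r, ε K * Y k ≤ 1 / ((r : ℝ) + 1)) ∧ ∀ s t : Fin N, s ≠ t → ∀ n ∈ A₀ K,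
      (∀ i p : ℕ+, i ≤ l r → p ≤ l r → (f s)^[n] i = (f t)^[n] p →
        ‖weightProd (f s) (w s) i n / weightProd (f t) (w t) p n - d r s i / d r t p‖ ≤
          1 / ((r : ℝ) + 1) / Y r) ∧
      (∀ i p : ℕ+, l r < i → p ≤ l r → (f s)^[n] i = (f t)^[n] p →
        ‖weightProd (f s) (w s) i n‖ / ‖weightProd (f t) (w t) p n‖ ≤ 1 / ((r : ℝ) + 1) / Y r)
  have hP : ∀ r K₀, ∃ K, K₀ ≤ K ∧ P r K := by
    intro r K₀
    have hev : ∀ᶠ K in atTop, ε K < 1 ∧ ∀ k ∈ Iic r, ε K * Y k ≤ 1 / ((r : ℝ) + 1) := by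
      refine (hε.eventually (gt_mem_nhds one_pos)).and
        ((eventually_all_finite (finite_Iic r)).2 fun k _ => ?_)
      have := hε.mul_const (Y k)
      rw [zero_mul] at this
      exact (this.eventually (gt_mem_nhds (hr0 r))).mono fun K hK => hK.le
    obtain ⟨K₁, hK₁⟩ := eventually_atTop.1 hev
    obtain ⟨K, hK, hKA⟩ := exists_large_index_of_ratio_approx h4 (l r) (max (max K₀ K₁) (l r))
      (hd r) (div_pos (hr0 r) (hY0 r))
    have hK1 := hK₁ K ((le_max_right _ _).trans ((le_max_left _ _).trans hK))
    exact ⟨K, (le_max_left _ _).trans ((le_max_left _ _).trans hK),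
      (le_max_right _ _).trans hK, hK1.1, hK1.2, hKA⟩
  obtain ⟨φ, hφ, hPφ⟩ := extraction_forall_of_frequently
    (P := fun r k => P r k.succPNat) (fun r => frequently_atTop.2 fun k₀ => by
      obtain ⟨K, hK, hPK⟩ := hP r k₀.succPNat
      refine ⟨K.natPred, ?_, by simpa using hPK⟩
      have : (k₀.succPNat : ℕ) ≤ K := hK
      rw [Nat.succPNat_coe] at this
      have := K.natPred_add_one
      omega)
  let L : ℕ → ℕ+ := fun r => (φ r).succPNat
  have hL : StrictMono L := Nat.succPNat_strictMono.comp hφ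
  have hPL : ∀ r, P r (L r) := hPφ
  have hεY : ∀ r k, k ≤ r → ε (L r) * Y k ≤ 1 / ((r : ℝ) + 1) := fun r => (hPL r).2.2.1
  have hεY' : ∀ r k, r ≤ k → ε (L k) * Y k ≤ 1 / ((r : ℝ) + 1) := fun r k hrk =>
    (hεY k k le_rfl).trans (by gcongr)
  have hn₀ : ∀ r, ∃ n₀, ∀ n ∈ A (L r), n₀ ≤ n → ∀ t, ∀ p ≤ l r,
      ‖d r t p / weightProd (f t) (w t) p n‖ ≤ 1 / ((r : ℝ) + 1) := by
    intro r
    have h : ∀ᶠ n in atTop ⊓ 𝓟 (A₀ (L r)), ∀ t, ∀ p ∈ Iic (l r),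
        ‖d r t p / weightProd (f t) (w t) p n‖ ≤ 1 / ((r : ℝ) + 1) := by
      refine eventually_all.2 fun t => (eventually_all_finite (finite_Iic (l r))).2 fun p hp => ?_
      have h5 : Tendsto (fun n => ‖d r t p / weightProd (f t) (w t) p n‖)
          (atTop ⊓ 𝓟 (A₀ (L r))) (𝓝 0) := by
        simp only [norm_div]
        exact tendsto_const_nhds.div_atTop (h1 p (L r) (le_trans hp (hPL r).1) t)
      exact (h5.eventually (gt_mem_nhds (hr0 r))).mono fun n hn => hn.le
    rw [eventually_inf_principal] at h
    obtain ⟨n₀, hn₀⟩ := eventually_atTop.1 h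
    exact ⟨n₀, fun n hn hn' => hn₀ n hn' (hAA₀ _ hn)⟩
  choose n₀ hn₀ using hn₀
  -- Cutting off the times before `n₀ r` makes all quotients of the `r`-th array at most `1 / (r +
  -- 1)`.
  let B : ℕ → Set ℕ := fun r => A (L r) ∩ Ici (n₀ r)
  have hBA : ∀ r, B r ⊆ A₀ (L r) := fun r n hn => hAA₀ _ hn.1
  have hlt : ∀ r k n, n ∈ B r → n ∈ B k → ¬ r < k := by
    intro r k n hr hk hrk
    -- At a common time the index `L r + 1` lies beyond `L r` but not beyond `L k`, so its weight
    -- ratio with itself, namely `1`, would be at most `ε (L r) < 1`.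
    have h := h1' (L r) (L k) n (hBA r hr) n (hBA k hk) ⟨0, by omega⟩ (L r + 1) (L r + 1)
      (PNat.lt_add_right _ _) (PNat.add_one_le_iff.2 (hL hrk)) rfl
    rw [div_self (norm_ne_zero_iff.2 (hW _ _ _))] at h
    exact (h.trans (min_le_left _ _)).not_gt (hPL r).2.1
  have hratio : ∀ {c e : ℝ} (k : ℕ) (t : Fin N) (p : ℕ+), p ≤ l k → 0 ≤ c → c ≤ e →
      c * ‖d k t p‖ ≤ e * Y k := fun k t p hp hc hce =>
    mul_le_mul hce (hY k t p hp) (norm_nonneg _) (hc.trans hce)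
  obtain ⟨x, hx⟩ := exists_approximating_vector (f := f) hf (w := w) (l := l) (L := L) (d := d)
    (A := B) (fun r => (hPL r).1) hW
    (fun r k n hn m hm hmn s t i hi p hp hij =>
      (hAdisj (L r) (L k) n hn.1 m hm.1 hmn.symm s t).subset
        ⟨mem_image_of_mem _ hi, hij ▸ mem_image_of_mem _ hp⟩)
    (fun r k n hr hk => le_antisymm (not_lt.1 (hlt k r n hk hr)) (not_lt.1 (hlt r k n hr hk)))
    (fun r n hn => hn₀ r n hn.1 hn.2)
    (fun r t p hp => (h1 p (L r) (hp.trans (hPL r).1) t).mono_left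
      (inf_le_inf_left _ (principal_mono.2 (hBA r))))
    (by
      intro r k n hn m hm s t i hi p hp hmn hij
      have hpL : p ≤ L k := hp.trans (hPL k).1
      have hc : 0 ≤ ‖weightProd (f s) (w s) i n‖ / ‖weightProd (f t) (w t) p m‖ := by positivity
      -- The entry of size `Y k` must be beaten by the `ε` of the later set: `ε (L k)` from
      -- condition 2 if `r ≤ k`, `ε (L r)` from condition 3 if `k < r`. Condition 1 gives either
      -- when `s = t`.
      rcases le_or_gt r k with hrk | hrk
      · refine (hratio k t p hp hc ?_).trans (hεY' r k hrk)
        by_cases hst : s = t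
        · subst hst
          exact (h1' (L r) (L k) n (hBA r hn) m (hBA k hm) s i p hi hpL hij).trans
            (min_le_right _ _)
        · exact h2 p (L k) (L r) hpL n (hBA r hn) s t hst m (hBA k hm) hmn i hi hij
      · refine (hratio k t p hp hc ?_).trans (hεY r k hrk.le)
        by_cases hst : s = t
        · subst hst
          exact (h1' (L r) (L k) n (hBA r hn) m (hBA k hm) s i p hi hpL hij).trans
            (min_le_left _ _)
        · exact h3 p (L k) (L r) hpL (hL hrk) n (hBA r hn) s t hst m (hBA k hm) i hi hij)
    (by
      intro r n hn s t hst i hi p hp hij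
      have h := ((hPL r).2.2.2 s t hst n (hBA r hn)).1 i p hi hp hij
      have heq : weightProd (f s) (w s) i n / weightProd (f t) (w t) p n * d r t p - d r s i =
          (weightProd (f s) (w s) i n / weightProd (f t) (w t) p n - d r s i / d r t p) *
            d r t p := by
        rw [sub_mul, div_mul_cancel₀ _ (hd r t p)]
      rw [heq, norm_mul]
      exact (hratio r t p hp (norm_nonneg _) h).trans (div_mul_cancel₀ _ (hY0 r).ne').le)
    (by
      intro r n hn s t hst i hi p hp hij
      have h := ((hPL r).2.2.2 s t hst n (hBA r hn)).2 i p hi hp hij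
      exact (hratio r t p hp (by positivity) h).trans (div_mul_cancel₀ _ (hY0 r).ne').le)
  refine ⟨x, fun U hU ⟨z, hz⟩ => ?_⟩
  obtain ⟨ρ, hρ, hball⟩ := Metric.isOpen_iff.1 hU z hz
  have hρ4 : 0 < ρ / 4 := by positivity
  obtain ⟨l₀, hl₀⟩ : ∃ l₀ : ℕ+, ∀ s, ∀ i > l₀, ‖z s i‖ < ρ / 4 := by
    have hev : ∀ᶠ i in cofinite, ∀ s, ‖z s i‖ < ρ / 4 := eventually_all.2 fun s => by
      have := (c0_tendsto_cofinite (z s)).norm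
      rw [norm_zero] at this
      exact this.eventually (gt_mem_nhds hρ4)
    obtain ⟨b, hb⟩ := (eventually_cofinite.1 hev).bddAbove
    exact ⟨b, fun s i hi => by_contra fun hcon => (hb fun hall => hcon (hall s)).not_gt hi⟩
  obtain ⟨R, hR⟩ := exists_nat_one_div_lt hρ4
  obtain ⟨r, hRr, hlr, hdr⟩ := hdense l₀ (fun s i => z s i) (ρ / 4) hρ4 R
  have hrρ : 1 / ((r : ℝ) + 1) < ρ / 4 := lt_of_le_of_lt (by gcongr) hR
  -- Only a tail of `A (L r)` is known to consist of return times, which is enough for membership in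
  -- the family.
  refine mem_family_of_tail_subset h𝒜 (hA (L r)) (n₀ := n₀ r) fun n hn => hball ?_
  rw [mem_ball_iff_norm]
  refine lt_of_le_of_lt ((pi_norm_le_iff_of_nonneg (half_pos hρ).le).2 fun s => ?_)
    (half_lt_self hρ)
  rw [Pi.sub_apply, piMap_pow_apply]
  refine c0_norm_le (half_pos hρ).le fun i => ?_
  rw [ZeroAtInftyContinuousMap.sub_apply, pseudoShift_pow_apply]
  obtain ⟨hle, hgt⟩ := hx r n hn s i
  rw [hlr] at hle hgt
  rcases le_or_gt i l₀ with hi | hi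
  · linarith [norm_sub_le_norm_sub_add_norm_sub
      (weightProd (f s) (w s) i n * x ((f s)^[n] i)) (d r s i) (z s i), hle hi, hdr s i hi]
  · linarith [norm_sub_le (weightProd (f s) (w s) i n * x ((f s)^[n] i)) (z s i), hgt hi,
      hl₀ s i hi]

end

/-! ### The equivalence -/

theorem mainTheorem3 {𝕜 : Type*} [RCLike 𝕜] (N : ℕ) (hN : 2 ≤ N)
    (f : Fin N → ℕ+ → ℕ+) (hf : ∀ s, StrictMono (f s)) (hf1 : ∀ s, 1 < f s 1)
    (w : Fin N → ℕ+ → 𝕜) (hw : ∀ s, ∃ C : ℝ, ∀ j, ‖w s (f s j)‖ ≤ C)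
    (𝒜 : Set (Set ℕ))
    (h𝒜 : 𝒜 = infiniteSets ∨ 𝒜 = posUpperBanachDens ∨ 𝒜 = posUpperDens ∨ 𝒜 = posLowerDens)
    (hreg : WeaklyPartitionRegular f 𝒜) :
    DisjointHypercyclic 𝒜 (fun s => pseudoShift (f s) (hf s) (w s) (hw s)) ↔
      ∃ (A : ℕ+ → Set ℕ) (ε : ℕ+ → ℝ),
        (∀ k, A k ∈ 𝒜) ∧ (∀ k, 0 < ε k) ∧ Tendsto ε atTop (𝓝 0) ∧
        -- the weight products tend to infinity along the sets `A k`
        (∀ j k : ℕ+, j ≤ k → ∀ s : Fin N,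
          Tendsto (fun n => ‖weightProd (f s) (w s) j n‖) (atTop ⊓ 𝓟 (A k)) atTop) ∧
        -- the bound on the ratios of weight products of a single operator
        (∀ l k : ℕ+, ∀ n ∈ A l, ∀ m ∈ A k, ∀ s : Fin N, ∀ i p : ℕ+, l < i → p ≤ k →
          (f s)^[n] i = (f s)^[m] p →
            ‖weightProd (f s) (w s) i n‖ / ‖weightProd (f s) (w s) p m‖ ≤ min (ε l) (ε k)) ∧
        -- the bounds on the ratios for two different operators at different times
        (∀ j l k : ℕ+, j ≤ l → ∀ n ∈ A k, ∀ s t : Fin N, s ≠ t → ∀ m ∈ A l, m ≠ n →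
          ∀ i : ℕ+, k < i → (f s)^[n] i = (f t)^[m] j →
            ‖weightProd (f s) (w s) i n‖ / ‖weightProd (f t) (w t) j m‖ ≤ ε l) ∧
        (∀ j k l : ℕ+, j ≤ k → k < l → ∀ n ∈ A l, ∀ s t : Fin N, s ≠ t → ∀ m ∈ A k,
          ∀ i : ℕ+, l < i → (f s)^[n] i = (f t)^[m] j →
            ‖weightProd (f s) (w s) i n‖ / ‖weightProd (f t) (w t) j m‖ ≤ ε l) ∧
        -- the approximation of prescribed ratios
        (∀ (l : ℕ+) (a : Fin N → ℕ+ → 𝕜), (∀ s, ∀ j ≤ l, a s j ≠ 0) → ∀ δ : ℝ, 0 < δ →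
          ∃ L : ℕ+, l ≤ L ∧ ∀ s t : Fin N, s ≠ t → ∀ n ∈ A L,
            (∀ i p : ℕ+, i ≤ l → p ≤ l → (f s)^[n] i = (f t)^[n] p →
              ‖weightProd (f s) (w s) i n / weightProd (f t) (w t) p n - a s i / a t p‖ ≤ δ) ∧
            (∀ i p : ℕ+, l < i → p ≤ l → (f s)^[n] i = (f t)^[n] p →
              ‖weightProd (f s) (w s) i n‖ / ‖weightProd (f t) (w t) p n‖ ≤ δ)) := by
  constructor
  · exact exists_sets_of_disjointHypercyclic hf hf1 hw
  · rintro ⟨A, ε, hA, -, hε, h1, h1', h2, h3, h4⟩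
    exact disjointHypercyclic_of_exists_sets hN hf hw h𝒜 hreg hA hε h1 h1' h2 h3 h4
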